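/- All groups are finite. Let $G$ be a group. For a subset $S\subseteq G$ with $S^{-1}=S$ and $1\notin S$, the Cayley graph $\mathrm{Cay}(G,S)$ is the graph with vertex set $G$ and edge set $\{\{g,sg\} : g\in G,\ s\in S\}$; it is regular of valency $|S|$. A finite graph is called integral if all eigenvalues of its adjacency matrix are integers. Let $\mathcal G_3$ be the class of finite groups $G$ such that $\mathrm{Cay}(G,S)$ is integral for every such $S$ with $|S|\le 3$. Let $\mathcal A_3$ be the class of finite groups $G$ that have at least one Cayley graph of valency $3$ and all of whose Cayley graphs of valency $3$ are integral. Then a finite group $G$ belongs to $\mathcal G_3$ if and only if $G$ is a $3$-group of exponent $3$, or $G\in\mathcal A_3$, or $|G|\le 2$. -/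

import Mathlib

namespace CayleyIntegral

/-- A finite simple graph is integral if every eigenvalue of its adjacency matrix
(every complex one, hence all of them) is a rational integer. -/
def IsIntegralGraph {V : Type*} [Finite V] (Γ : SimpleGraph V) : Prop :=
  letI : Fintype V := Fintype.ofFinite V
  letI : DecidableEq V := Classical.decEq V
  letI : DecidableRel Γ.Adj := Classical.decRel Γ.Adj
  ∀ μ : ℂ, Module.End.HasEigenvalue (Matrix.toLin' (Γ.adjMatrix ℂ)) μ → ∃ n : ℤ, μ = n

/-- The symmetric subsets of `G` not containing the identity. -/
def IsConnectionSet {G : Type*} [Group G] (S : Set G) : Prop :=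
  (∀ s, s ∈ S ↔ s⁻¹ ∈ S) ∧ (1 : G) ∉ S

/-- The Cayley graph with vertex set `G` and edge set `{{g, s * g} : g ∈ G, s ∈ S}`;
it is only used for connection sets `S`, and then has valency `S.ncard`. -/
def Cay {G : Type*} [Group G] (S : Set G) : SimpleGraph G :=
  SimpleGraph.fromRel fun g h => ∃ s ∈ S, h = s * g

/-- The class `𝒢ₖ`: all Cayley graphs of `G` with connection set of size at most `k`
are integral. -/
def InG (k : ℕ) (G : Type*) [Group G] [Finite G] : Prop :=
  ∀ S : Set G, IsConnectionSet S → S.ncard ≤ k → IsIntegralGraph (Cay S)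

/-- The class `𝒜ₖ`: `G` has a Cayley graph of valency `k`, and all Cayley graphs of `G` of
valency `k` are integral. (In particular a group of odd order is in no `𝒜ₖ` with `k` odd.) -/
def InA (k : ℕ) (G : Type*) [Group G] [Finite G] : Prop :=
  (∃ S : Set G, IsConnectionSet S ∧ S.ncard = k) ∧
    ∀ S : Set G, IsConnectionSet S → S.ncard = k → IsIntegralGraph (Cay S)

end CayleyIntegral

/-!
The content is that a group `G` in `𝒜₃` has integral Cayley graphs of valency at most two as well.
Those are disjoint unions of edges and cycles, so what is needed is that elements of `G` have order
`1, 2, 3, 4` or `6` and that the product of two distinct involutions has order `2` or `3`.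

Information about `G` is extracted from a cubic graph `Cay S` by a test function: for a subgroup `M`
normalised by `y`, with `⟨y⟩ ∩ M` trivial, there is a nonzero `f : G → ℂ` with `f (y * g) = ζ * f g`
and `f (h * g) = f g` for `h ∈ M` (`exists_semiinvariant`). On it the adjacency operator, or the
square of an integral translate of it, acts as a scalar involving `2 cos (2π / n)`, where `n` is the
order of `y`; for `n ≥ 3` integrality then forces `n ∈ {3, 4, 6}` (`eq_of_two_cos_int`).

* If `x` has even order `n`, use `S = {x, x⁻¹, x ^ (n / 2)}` (`pow_eq_one_of_even_orderOf`).
* If `a`, `b` are involutions, use `S = {a, b, z}` with `z` the central involution of `⟨a, b⟩`, or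
  `S = {a, b, a * b * a}` if there is none (`mul_pow_eq_one_of_involutions`).
* Let `x` have odd order. As a symmetric set of size three contains an involution, there is an
  involution `a`. If its conjugates under `⟨x⟩` commute, they generate an elementary abelian
  `2`-group `M`, and `S = {a, x, x⁻¹}` gives `x ^ 3 = 1` (`pow_three_of_commuting_conjugates`).
  Otherwise `G` has two noncommuting involutions `a`, `b`. Then `a`, `b` and `a * b * a` are the only
  involutions of `G` (`eq_of_involution`): a further one `c` would make `⟨a * b, a * c⟩` a group of
  exponent three with a character that yields the eigenvalue `±√3` of `Cay {a, b, c}`.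
  So `x` normalises `⟨a, b⟩`, and an element of odd order centralising an involution has order
  dividing three by the even case.

Conversely a group in `𝒢₃` of order at least three without cubic Cayley graphs has no involution, so
the cycles `Cay {x, x⁻¹}` leave only elements of order one and three.
-/

namespace CayleyIntegral

variable {G : Type*} [Group G]

/-! ### Adjacency operators of Cayley graphs -/

/-- The adjacency operator `f ↦ (g ↦ ∑ s ∈ S, f (s * g))` of `Cay S`, on complex functions. -/
def adjOp (S : Finset G) (f : G → ℂ) (g : G) : ℂ := ∑ s ∈ S, f (s * g)

theorem cay_adj {S : Set G} (hS : IsConnectionSet S) (g h : G) :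
    (Cay S).Adj g h ↔ ∃ s ∈ S, h = s * g := by
  unfold Cay
  rw [SimpleGraph.fromRel_adj]
  constructor
  · rintro ⟨-, ⟨s, hs, rfl⟩ | ⟨s, hs, rfl⟩⟩
    · exact ⟨s, hs, rfl⟩
    · exact ⟨s⁻¹, (hS.1 s).1 hs, by simp⟩
  · rintro ⟨s, hs, rfl⟩
    refine ⟨fun h => hS.2 ?_, Or.inl ⟨s, hs, rfl⟩⟩
    have : s = 1 := by simpa using h
    rwa [← this]

theorem isIntegralGraph_cay_iff [Finite G] {S : Finset G} (hS : IsConnectionSet (S : Set G)) :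
    IsIntegralGraph (Cay (S : Set G)) ↔
      ∀ (μ : ℂ) (f : G → ℂ), f ≠ 0 → (∀ g, adjOp S f g = μ * f g) → ∃ n : ℤ, μ = n := by
  classical
  unfold IsIntegralGraph
  let _ : Fintype G := Fintype.ofFinite G
  let _ : DecidableRel (Cay (S : Set G)).Adj := Classical.decRel _
  have key : ∀ f : G → ℂ, Matrix.toLin' ((Cay (S : Set G)).adjMatrix ℂ) f = adjOp S f := by
    intro f
    funext g
    rw [Matrix.toLin'_apply, SimpleGraph.adjMatrix_mulVec_apply, adjOp,
      ← Finset.sum_image (g := fun s => s * g) (f := f) (by intro x _ y _ h; simpa using h)]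
    congr 1
    ext h
    simp only [SimpleGraph.mem_neighborFinset, cay_adj hS, Finset.mem_image, Finset.mem_coe]
    exact ⟨fun ⟨s, hs, e⟩ => ⟨s, hs, e.symm⟩, fun ⟨s, hs, e⟩ => ⟨s, hs, e.symm⟩⟩
  constructor
  · intro h μ f hf hT
    refine h μ (Module.End.hasEigenvalue_of_hasEigenvector (x := f) ?_)
    refine ⟨Module.End.mem_eigenspace_iff.2 ?_, hf⟩
    exact (key f).trans (funext hT)
  · intro h μ hμ
    obtain ⟨f, hf, hf0⟩ := hμ.exists_hasEigenvector
    refine h μ f hf0 fun g => ?_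
    have h1 := Module.End.mem_eigenspace_iff.1 hf
    have h2 : Matrix.toLin' ((Cay (S : Set G)).adjMatrix ℂ) f = μ • f := by
      convert h1
    rw [key] at h2
    rw [h2]; rfl

theorem isConnectionSet_triple {a b c : G} (ha : a ≠ 1) (hb : b ≠ 1) (hc : c ≠ 1)
    (h : ∀ s ∈ ({a, b, c} : Set G), s⁻¹ ∈ ({a, b, c} : Set G)) :
    IsConnectionSet ({a, b, c} : Set G) := by
  refine ⟨fun s => ⟨h s, fun hs => by simpa using h _ hs⟩, ?_⟩
  simp [ha.symm, hb.symm, hc.symm]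

theorem exists_int_of_triple [Finite G] (hA : InA 3 G) {a b c : G}
    (hS : IsConnectionSet ({a, b, c} : Set G)) (hab : a ≠ b) (hac : a ≠ c) (hbc : b ≠ c)
    {μ : ℂ} {f : G → ℂ} (hf : f ≠ 0)
    (h : ∀ g, f (a * g) + f (b * g) + f (c * g) = μ * f g) : ∃ n : ℤ, μ = n := by
  classical
  have e : (({a, b, c} : Finset G) : Set G) = {a, b, c} := by simp
  have hI := hA.2 _ hS (by rw [← e, Set.ncard_coe_finset, Finset.card_eq_three]
                           exact ⟨a, b, c, hab, hac, hbc, rfl⟩)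
  rw [← e] at hI hS
  refine (isIntegralGraph_cay_iff hS).1 hI μ f hf fun g => ?_
  rw [← h, adjOp, Finset.sum_insert (by simp [hab, hac]), Finset.sum_pair hbc, add_assoc]

/-- If the adjacency operator `T` of a cubic Cayley graph satisfies `(T - k)² f = d f` with `k` an
integer and `f ≠ 0`, then one of `k ± √d` is an eigenvalue of `T`, so `d` is a perfect square. -/
theorem exists_int_sq_of_triple [Finite G] (hA : InA 3 G) {a b c : G}
    (hS : IsConnectionSet ({a, b, c} : Set G)) (hab : a ≠ b) (hac : a ≠ c) (hbc : b ≠ c)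
    (k : ℤ) {d : ℂ} {f T : G → ℂ} (hf : f ≠ 0)
    (hT : ∀ g, T g = f (a * g) + f (b * g) + f (c * g))
    (h : ∀ g, T (a * g) + T (b * g) + T (c * g) = 2 * k * T g + (d - k ^ 2) * f g) :
    ∃ n : ℤ, d = n ^ 2 := by
  obtain ⟨s, rfl⟩ : ∃ s : ℂ, d = s ^ 2 := by
    obtain ⟨s, hs⟩ := IsAlgClosed.exists_pow_nat_eq d (n := 2) (by norm_num)
    exact ⟨s, hs.symm⟩
  by_cases h0 : ∀ g, T g = (k - s) * f g
  · obtain ⟨n, hn⟩ := exists_int_of_triple hA hS hab hac hbc hf (fun g => (hT g).symm.trans (h0 g))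
    refine ⟨k - n, ?_⟩
    push_cast
    rw [← hn]; ring
  · have hF : (fun g => T g - (k - s) * f g) ≠ 0 := by
      intro H
      exact h0 fun g => sub_eq_zero.1 (congrFun H g)
    obtain ⟨n, hn⟩ := exists_int_of_triple hA hS hab hac hbc hF (μ := k + s) (by
      intro g
      linear_combination h g - (k - s) * (hT g).symm)
    refine ⟨n - k, ?_⟩
    push_cast
    rw [← hn]; ring

/-! ### Test functions -/

/-- A function spanning a one-dimensional character of `⟨M, y⟩` that is trivial on `M` and takes the
value `ζ` at `y`, extended by zero to the whole group. -/
theorem exists_semiinvariant (M : Subgroup G) (y : G) {n : ℕ} (hn : 0 < n) (hy : y ^ n = 1)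
    (hM : ∀ h ∈ M, y⁻¹ * h * y ∈ M) (hd : ∀ i < n, y ^ i ∈ M → i = 0) {ζ : ℂ} (hζ : ζ ^ n = 1) :
    ∃ f : G → ℂ, f ≠ 0 ∧ (∀ g, f (y * g) = ζ * f g) ∧ ∀ h ∈ M, ∀ g, f (h * g) = f g := by
  classical
  have hMi : ∀ i : ℕ, ∀ h ∈ M, (y ^ i)⁻¹ * h * y ^ i ∈ M := by
    intro i
    induction i with
    | zero => simp
    | succ i ih =>
      intro h hh
      have := ih _ (hM h hh)
      simpa [pow_succ', mul_assoc] using this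
  refine ⟨fun g => ∑ i ∈ Finset.range n, if (y ^ i)⁻¹ * g ∈ M then ζ ^ i else 0, ?_, ?_, ?_⟩
  · intro H
    have h1 := congrFun H 1
    simp only [mul_one, inv_mem_iff, Pi.zero_apply] at h1
    rw [Finset.sum_eq_single_of_mem 0 (Finset.mem_range.2 hn)] at h1
    · simp at h1
    · intro i hi hi0
      rw [if_neg fun hm => hi0 (hd i (Finset.mem_range.1 hi) hm)]
  · intro g
    set F : ℕ → ℂ := fun i => if (y ^ i)⁻¹ * (y * g) ∈ M then ζ ^ i else 0 with hF
    have h1 := (Finset.sum_range_succ' F n).symm.trans (Finset.sum_range_succ F n)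
    have h2 : F n = F 0 := by simp [hF, hy, hζ]
    rw [h2] at h1
    refine (add_right_cancel h1).symm.trans ?_
    rw [Finset.mul_sum]
    refine Finset.sum_congr rfl fun i _ => ?_
    simp only [hF, pow_succ', mul_inv_rev, mul_assoc, inv_mul_cancel_left, mul_ite, mul_zero]
  · intro h hh g
    refine Finset.sum_congr rfl fun i _ => ?_
    have : (y ^ i)⁻¹ * (h * g) = ((y ^ i)⁻¹ * h * y ^ i) * ((y ^ i)⁻¹ * g) := by group
    rw [this, Subgroup.mul_mem_cancel_left _ (hMi i h hh)]

/-- The case `M = ⊥`. -/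
theorem exists_semiinvariant_orderOf [Finite G] (y : G) {ζ : ℂ} (hζ : ζ ^ orderOf y = 1) :
    ∃ f : G → ℂ, f ≠ 0 ∧ ∀ g, f (y * g) = ζ * f g := by
  obtain ⟨f, h1, h2, -⟩ := exists_semiinvariant ⊥ y (orderOf_pos y) (pow_orderOf_eq_one y)
    (by simp) (fun i hi h => by
      by_contra h0
      exact pow_ne_one_of_lt_orderOf h0 hi (Subgroup.mem_bot.1 h)) hζ
  exact ⟨f, h1, h2⟩

/-! ### Roots of unity with rational trace -/

/-- The crystallographic restriction; for `n = 5` and `n ≥ 7` the number `2 cos (2π / n)` lies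
strictly between consecutive integers. -/
theorem eq_of_two_cos_int {n : ℕ} (hn : 3 ≤ n) {k : ℤ} (h : 2 * Real.cos (2 * Real.pi / n) = k) :
    n = 3 ∨ n = 4 ∨ n = 6 := by
  have hpi := Real.pi_pos
  have hn0 : (0 : ℝ) < n := by positivity
  by_contra hne
  push Not at hne
  obtain ⟨h3, h4, h6⟩ := hne
  rcases (by omega : n = 5 ∨ 7 ≤ n) with rfl | h7
  · have l1 : Real.cos (Real.pi / 2) < Real.cos (2 * Real.pi / (5 : ℕ)) :=
      Real.cos_lt_cos_of_nonneg_of_le_pi (by positivity) (by linarith) (by push_cast; linarith)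
    have l2 : Real.cos (2 * Real.pi / (5 : ℕ)) < Real.cos (Real.pi / 3) :=
      Real.cos_lt_cos_of_nonneg_of_le_pi (by positivity) (by push_cast; linarith)
        (by push_cast; linarith)
    rw [Real.cos_pi_div_two] at l1
    rw [Real.cos_pi_div_three] at l2
    have a1 : (0 : ℝ) < k := by linarith
    have a2 : (k : ℝ) < 1 := by linarith
    norm_cast at a1 a2
    omega
  · have h7' : (7 : ℝ) ≤ n := by exact_mod_cast h7
    have l0 : 2 * Real.pi / n < Real.pi / 3 := by
      rw [div_lt_div_iff₀ hn0 (by norm_num)]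
      nlinarith
    have l1 : Real.cos (Real.pi / 3) < Real.cos (2 * Real.pi / n) :=
      Real.cos_lt_cos_of_nonneg_of_le_pi (by positivity) (by linarith) l0
    have l2 : Real.cos (2 * Real.pi / n) < Real.cos 0 :=
      Real.cos_lt_cos_of_nonneg_of_le_pi le_rfl (by linarith) (by positivity)
    rw [Real.cos_pi_div_three] at l1
    rw [Real.cos_zero] at l2
    have a1 : (1 : ℝ) < k := by linarith
    have a2 : (k : ℝ) < 2 := by linarith
    norm_cast at a1 a2
    omega

theorem exists_root_of_unity {n : ℕ} (hn : 0 < n) : ∃ ζ : ℂ, IsPrimitiveRoot ζ n ∧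
    ζ + ζ⁻¹ = ((2 * Real.cos (2 * Real.pi / n) : ℝ) : ℂ) := by
  refine ⟨Complex.exp (2 * Real.pi * Complex.I / n),
    Complex.isPrimitiveRoot_exp n hn.ne', ?_⟩
  rw [← Complex.exp_neg]
  push_cast
  rw [Complex.cos]
  ring_nf

theorem eq_of_root_add_inv_int {n : ℕ} (hn : 3 ≤ n) {ζ : ℂ}
    (h : ζ + ζ⁻¹ = ((2 * Real.cos (2 * Real.pi / n) : ℝ) : ℂ)) {k : ℤ} (hk : ζ + ζ⁻¹ = k) :
    n = 3 ∨ n = 4 ∨ n = 6 := by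
  refine eq_of_two_cos_int hn (k := k) ?_
  rw [h] at hk
  exact_mod_cast hk

/-! ### Values of test functions -/

theorem inv_mul_eq_of_semiinvariant {f : G → ℂ} {y : G} {ζ : ℂ} (hζ : ζ ≠ 0)
    (h : ∀ g, f (y * g) = ζ * f g) (g : G) : f (y⁻¹ * g) = ζ⁻¹ * f g := by
  have := h (y⁻¹ * g)
  rw [mul_inv_cancel_left] at this
  rw [this, inv_mul_cancel_left₀ hζ]

theorem pow_mul_eq_of_semiinvariant {f : G → ℂ} {y : G} {ζ : ℂ}
    (h : ∀ g, f (y * g) = ζ * f g) (i : ℕ) (g : G) : f (y ^ i * g) = ζ ^ i * f g := by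
  induction i with
  | zero => simp
  | succ i ih => rw [pow_succ', mul_assoc, h, ih, pow_succ', mul_assoc]

theorem primitiveRoot_pow_half {n : ℕ} (hn : 0 < n) {ζ : ℂ} (h : IsPrimitiveRoot ζ (2 * n)) :
    ζ ^ n = -1 := by
  have h2 : (ζ ^ n) ^ 2 = 1 := by rw [← pow_mul, mul_comm, h.pow_eq_one]
  rcases (sq_eq_sq_iff_eq_or_eq_neg.1 (h2.trans (one_pow 2).symm)) with h3 | h3
  · exact absurd (Nat.le_of_dvd hn (h.dvd_of_pow_eq_one n h3)) (by omega)
  · exact h3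

/-! ### Elements of even order and pairs of involutions -/

/-- Choosing `ζ` primitive, `x ^ k` acts as `ζ ^ k = -1` for `orderOf x = 2 * k`, so that
`Cay {x, x⁻¹, x ^ k}` has the eigenvalue `2 cos (2π / (2k)) - 1`. -/
theorem pow_eq_one_of_even_orderOf [Finite G] (hA : InA 3 G) {x : G} (he : Even (orderOf x)) :
    x ^ 4 = 1 ∨ x ^ 6 = 1 := by
  obtain ⟨k, hk⟩ := he
  rw [← two_mul] at hk
  have hpos := orderOf_pos x
  have hx : ∀ j : ℕ, x ^ j = 1 ↔ 2 * k ∣ j := fun j => by rw [← hk, orderOf_dvd_iff_pow_eq_one]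
  have hne : ∀ j : ℕ, 0 < j → j < 2 * k → x ^ j ≠ 1 := fun j h0 hj h =>
    absurd (Nat.le_of_dvd h0 ((hx j).1 h)) (by omega)
  rcases (by omega : k = 1 ∨ 2 ≤ k) with rfl | h2
  · left
    rw [hx]; norm_num
  have hkk : x ^ k * x ^ k = 1 := by rw [← pow_add, hx, two_mul]
  obtain ⟨ζ, hζ, hcos⟩ := exists_root_of_unity (n := orderOf x) hpos
  have hζ0 : ζ ≠ 0 := hζ.ne_zero hpos.ne'
  obtain ⟨f, hf, hfx⟩ := exists_semiinvariant_orderOf x hζ.pow_eq_one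
  have hx1 : x ≠ 1 := by simpa using hne 1 one_pos (by omega)
  have hS : IsConnectionSet ({x, x⁻¹, x ^ k} : Set G) := by
    refine isConnectionSet_triple hx1 (inv_ne_one.2 hx1) (hne k (by omega) (by omega)) ?_
    rintro s (rfl | rfl | rfl)
    · simp
    · simp
    · rw [inv_eq_of_mul_eq_one_left hkk]; simp
  obtain ⟨m, hm⟩ := exists_int_of_triple hA hS (μ := ζ + ζ⁻¹ - 1) (f := f)
    (fun h => hne 2 (by omega) (by omega) (by rw [pow_two]; exact mul_eq_one_iff_eq_inv.2 h))
    (fun h => hne (k - 1) (by omega) (by omega) (by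
      have : x ^ (k - 1) * x = 1 * x := by
        rw [← pow_succ, Nat.sub_add_cancel (by omega), ← h, one_mul]
      exact mul_right_cancel this))
    (fun h => hne (k + 1) (by omega) (by omega) (by rw [pow_succ, ← h, inv_mul_cancel])) hf (by
      intro g
      rw [hfx, inv_mul_eq_of_semiinvariant hζ0 hfx, pow_mul_eq_of_semiinvariant hfx,
        primitiveRoot_pow_half (by omega) (hk ▸ hζ)]
      ring)
  have := eq_of_root_add_inv_int (by omega) hcos (k := m + 1) (by push_cast; rw [← hm]; ring)
  rw [hk] at this
  rw [hx, hx]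
  rcases this with h | h | h
  · omega
  · left; rw [h]
  · right; rw [h]

/-- The adjacency operator of `Cay {a, b, z}`, with `z` the central involution of `⟨a, b⟩`, has an
eigenvalue `-1 ± 2 cos (π / n)`, where `n` is the order of `a * b`; if `n` is odd, the graph
`Cay {a, b, a * b * a}` has an eigenvalue `±(1 + 2 cos (2π / n))`. -/
theorem mul_pow_eq_one_of_involutions [Finite G] (hA : InA 3 G) {a b : G} (ha : a * a = 1)
    (hb : b * b = 1) (ha1 : a ≠ 1) (hb1 : b ≠ 1) (hab : a ≠ b) :
    (a * b) ^ 2 = 1 ∨ (a * b) ^ 3 = 1 := by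
  have hai : a⁻¹ = a := inv_eq_of_mul_eq_one_left ha
  have hbi : b⁻¹ = b := inv_eq_of_mul_eq_one_left hb
  have hri : (a * b)⁻¹ = b * a := by rw [mul_inv_rev, hai, hbi]
  by_contra hcon
  push Not at hcon
  obtain ⟨hr2, hr3⟩ := hcon
  have hr1 : a * b ≠ 1 := fun h => hr2 (by rw [h, one_pow])
  have hpos := orderOf_pos (a * b)
  obtain ⟨ζ, hζ, hcos⟩ := exists_root_of_unity (n := orderOf (a * b)) hpos
  have hζ0 : ζ ≠ 0 := hζ.ne_zero hpos.ne'
  obtain ⟨f, hf, hfr⟩ := exists_semiinvariant_orderOf (a * b) hζ.pow_eq_one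
  have hfi := inv_mul_eq_of_semiinvariant hζ0 hfr
  rw [hri] at hfi
  have fab : ∀ g, f (a * (b * g)) = ζ * f g := fun g => by rw [← mul_assoc, hfr]
  have fba : ∀ g, f (b * (a * g)) = ζ⁻¹ * f g := fun g => by rw [← mul_assoc, hfi]
  have aa : ∀ g, a * (a * g) = g := fun g => by rw [← mul_assoc, ha, one_mul]
  have bb : ∀ g, b * (b * g) = g := fun g => by rw [← mul_assoc, hb, one_mul]
  rcases Nat.even_or_odd (orderOf (a * b)) with he | ho
  · -- `z` is the central involution of the dihedral group `⟨a, b⟩`.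
    obtain ⟨k, hk⟩ := id he
    rw [← two_mul] at hk
    set z := (a * b) ^ k with hz
    have hzz : z * z = 1 := by rw [hz, ← pow_add, ← two_mul, ← hk, pow_orderOf_eq_one]
    have hzi : z⁻¹ = z := inv_eq_of_mul_eq_one_left hzz
    have hz1 : z ≠ 1 := pow_ne_one_of_lt_orderOf (by omega) (by omega)
    have hcz : Commute z (a * b) := (Commute.refl (a * b)).pow_left k
    have hza : Commute z a := by
      have h : a * z * a⁻¹ = z⁻¹ := by
        rw [hz, ← conj_pow, ← inv_pow, hri, hai, ← mul_assoc, ha, one_mul]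
      rw [hzi] at h
      exact (mul_inv_eq_iff_eq_mul.1 h).symm
    have hbe : b = a * (a * b) := (aa b).symm
    have hzb : Commute z b := by rw [hbe]; exact hza.mul_right hcz
    have hra : ¬ Commute a (a * b) := by
      intro h
      apply hr2
      have h2 : b * a = a * b := by
        have := h.eq
        rw [aa, mul_assoc] at this
        calc b * a = a * (b * a) * a := by rw [← this]
          _ = a * b := by rw [mul_assoc, mul_assoc, ha, mul_one]
      rw [pow_two]
      nth_rw 1 [← h2]
      rw [mul_assoc, aa, hb]
    have haz : a ≠ z := fun h => hra (h ▸ hcz)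
    have hbz : b ≠ z := by
      intro h
      have h1 : Commute b (a * b) := h ▸ hcz
      have h2 : Commute a b := by
        have := h1.mul_right (show Commute b b⁻¹ from (Commute.refl b).inv_right)
        rw [mul_inv_cancel_right] at this
        exact this.symm
      exact hra ((Commute.refl a).mul_right h2)
    have hfz : ∀ g, f (z * g) = - f g := fun g => by
      rw [pow_mul_eq_of_semiinvariant hfr, primitiveRoot_pow_half (by omega) (hk ▸ hζ), neg_one_mul]
    have hS : IsConnectionSet ({a, b, z} : Set G) := by
      refine isConnectionSet_triple ha1 hb1 hz1 ?_
      rintro s (rfl | rfl | hs)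
      · simp [hai]
      · simp [hbi]
      · rw [Set.mem_singleton_iff] at hs
        simp [hs, hzi]
    obtain ⟨m, hm⟩ := exists_int_sq_of_triple hA hS hab haz hbz (-1) (d := 2 + (ζ + ζ⁻¹)) hf
      (fun g => rfl) (by
        intro g
        have e1 : a * (z * g) = z * (a * g) := by rw [← mul_assoc, ← hza.eq, mul_assoc]
        have e2 : b * (z * g) = z * (b * g) := by rw [← mul_assoc, ← hzb.eq, mul_assoc]
        simp only [aa, bb, e1, e2, hfz, fab, fba]
        push_cast
        ring)
    have hm' : ζ + ζ⁻¹ = ((m ^ 2 - 2 : ℤ) : ℂ) := by push_cast; rw [← hm]; ring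
    have h3 : 3 ≤ orderOf (a * b) := by
      have h0 : orderOf (a * b) ≠ 2 := fun h => hr2 (by rw [← h, pow_orderOf_eq_one])
      omega
    have hn := eq_of_root_add_inv_int h3 hcos hm'
    rw [hcos] at hm'
    have hm2 : 2 * Real.cos (2 * Real.pi / orderOf (a * b)) = ((m ^ 2 - 2 : ℤ) : ℝ) := by
      exact_mod_cast hm'
    -- For `n = 4, 6` the number `2 + 2 cos (2π / n)` is `2, 3`, not a square.
    have hsq : ∀ c : ℤ, m ^ 2 - 2 = c → c = 0 ∨ c = 1 → False := by
      intro c h1 h2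
      obtain ⟨hlo, hhi⟩ := abs_lt_of_sq_lt_sq' (show m ^ 2 < 2 ^ 2 by omega) (by norm_num)
      interval_cases m <;> omega
    rcases hn with h | h | h
    · omega
    · refine hsq 0 ?_ (Or.inl rfl)
      have : 2 * Real.pi / ((4 : ℕ) : ℝ) = Real.pi / 2 := by push_cast; ring
      rw [h, this, Real.cos_pi_div_two, mul_zero] at hm2
      exact_mod_cast hm2.symm
    · refine hsq 1 ?_ (Or.inr rfl)
      have : 2 * Real.pi / ((6 : ℕ) : ℝ) = Real.pi / 3 := by push_cast; ring
      rw [h, this, Real.cos_pi_div_three] at hm2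
      norm_num at hm2
      exact_mod_cast hm2.symm
  · have hodd : ∀ j : ℕ, (a * b) ^ (2 * j) = 1 → (a * b) ^ j = 1 := by
      intro j h
      rw [← orderOf_dvd_iff_pow_eq_one] at h ⊢
      exact (Nat.Coprime.dvd_mul_left (Nat.coprime_two_right.2 ho)).1 h
    have hba : b * a ≠ 1 := by rw [← hri]; exact inv_ne_one.2 hr1
    have hS : IsConnectionSet ({a, b, a * b * a} : Set G) := by
      refine isConnectionSet_triple ha1 hb1 ?_ ?_
      · intro h
        apply hb1
        calc b = a * (a * b * a) * a := by rw [mul_assoc a b a, aa, mul_assoc, ha, mul_one]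
          _ = 1 := by rw [h, mul_one, ha]
      · rintro s (rfl | rfl | hs)
        · simp [hai]
        · simp [hbi]
        · rw [Set.mem_singleton_iff] at hs
          simp [hs, hai, hbi, mul_assoc]
    have hc : b ≠ a * b * a := by
      intro h
      apply hr2
      rw [pow_two, ← mul_assoc, ← h, hb]
    have hac : a ≠ a * b * a := by
      intro h
      apply hba
      have : a * 1 = a * (b * a) := by rw [mul_one, ← mul_assoc, ← h]
      exact (mul_left_cancel this).symm
    obtain ⟨m, hm⟩ := exists_int_sq_of_triple hA hS hab hac hc 0
      (d := (1 + (ζ + ζ⁻¹)) ^ 2) hf (fun g => rfl) (by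
        intro g
        have e1 : f (a * (b * (a * (b * g)))) = ζ * (ζ * f g) := by rw [fab, fab]
        have e2 : f (b * (a * (b * (a * g)))) = ζ⁻¹ * (ζ⁻¹ * f g) := by rw [fba, fba]
        simp only [mul_assoc, aa, bb, e1, e2, fab, fba]
        push_cast
        have e3 : ζ * ζ⁻¹ = 1 := mul_inv_cancel₀ hζ0
        linear_combination (-2 * f g) * e3)
    have hm' : ∃ k : ℤ, ζ + ζ⁻¹ = k := by
      rcases sq_eq_sq_iff_eq_or_eq_neg.1 hm with h | h
      · exact ⟨m - 1, by push_cast; rw [← h]; ring⟩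
      · exact ⟨-m - 1, by push_cast; rw [← h]; ring⟩
    obtain ⟨k, hk⟩ := hm'
    have h1 : orderOf (a * b) ≠ 1 := fun h => hr1 (orderOf_eq_one_iff.1 h)
    obtain ⟨j, hj⟩ := ho
    rcases eq_of_root_add_inv_int (by omega) hcos hk with h | h | h
    · exact hr3 (by rw [← h, pow_orderOf_eq_one])
    · omega
    · omega

/-! ### Groups in which distinct involutions have a product of order two or three -/

theorem mul_comm_of_involutions {a b : G} (ha : a * a = 1) (hb : b * b = 1)
    (h : (a * b) ^ 2 = 1) : a * b = b * a := by
  have h1 : (a * b)⁻¹ = a * b := inv_eq_of_mul_eq_one_left (by rwa [← pow_two])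
  rw [← h1, mul_inv_rev, inv_eq_of_mul_eq_one_left ha, inv_eq_of_mul_eq_one_left hb]

theorem braid_of_involutions {a b : G} (ha : a * a = 1) (hb : b * b = 1)
    (h : (a * b) ^ 3 = 1) : b * a * b = a * b * a := by
  have h1 : (a * b * a) * (b * a * b) = 1 := by
    rw [← h]; simp only [pow_succ, pow_zero, one_mul, mul_assoc]
  rw [← inv_eq_of_mul_eq_one_right h1]
  simp only [mul_inv_rev, inv_eq_of_mul_eq_one_left ha, inv_eq_of_mul_eq_one_left hb, mul_assoc]

/-- Any two distinct involutions have a product of order `2` or `3`. -/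
def InvolutionProducts (G : Type*) [Group G] : Prop :=
  ∀ a b : G, a * a = 1 → b * b = 1 → a ≠ 1 → b ≠ 1 → a ≠ b → (a * b) ^ 2 = 1 ∨ (a * b) ^ 3 = 1

theorem InvolutionProducts.not_commute_both (hP : InvolutionProducts G) {a b c : G}
    (ha : a * a = 1) (hb : b * b = 1) (hc : c * c = 1) (hb1 : b ≠ 1) (hc1 : c ≠ 1)
    (hab : a ≠ b) (hac : a ≠ c) (h3 : (a * b) ^ 3 = 1) (h1 : a * c = c * a) :
    b * c ≠ c * b := by
  intro h2
  have hsq : (a * b) ^ 2 ≠ 1 := by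
    intro h
    have : a * b = 1 := by rw [pow_succ, h, one_mul] at h3; exact h3
    exact hab ((eq_inv_of_mul_eq_one_left this).trans (inv_eq_of_mul_eq_one_left hb))
  have hcub : c ^ 3 ≠ 1 := by rw [pow_succ, pow_two, hc, one_mul]; exact hc1
  have hcab : Commute c (a * b) := (show Commute c a from h1.symm).mul_right h2.symm
  have e : a * c * b = c * (a * b) := by rw [h1, mul_assoc]
  have hacb : a * c ≠ b := by
    rintro rfl
    apply hcub
    rwa [← mul_assoc, ha, one_mul] at h3
  rcases hP (a * c) b (by rw [mul_assoc, h1, ← mul_assoc c, hc, one_mul, ha]) hb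
    (fun h => hac ((eq_inv_of_mul_eq_one_left h).trans (inv_eq_of_mul_eq_one_left hc)))
    hb1 hacb with h | h
  · rw [e, hcab.mul_pow, pow_two c, hc, one_mul] at h
    exact hsq h
  · rw [e, hcab.mul_pow, h3, mul_one] at h
    exact hcub h

/-- An involution that fails to commute with some involution commutes with no other one: otherwise
the symmetric group on four letters occurs, in which a transposition and a double transposition can
have a product of order four. -/
theorem InvolutionProducts.pow_three (hP : InvolutionProducts G) {a b c : G}
    (ha : a * a = 1) (hb : b * b = 1) (hc : c * c = 1) (ha1 : a ≠ 1) (hb1 : b ≠ 1) (hc1 : c ≠ 1)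
    (hab : a ≠ b) (hac : a ≠ c) (h3 : (a * b) ^ 3 = 1) : (a * c) ^ 3 = 1 := by
  rcases hP a c ha hc ha1 hc1 hac with h | h
  swap
  · exact h
  exfalso
  have h1 := mul_comm_of_involutions ha hc h
  have h2 := hP.not_commute_both ha hb hc hb1 hc1 hab hac h3 h1
  have hbc : b ≠ c := fun h => h2 (by rw [h])
  have hbc3 : (b * c) ^ 3 = 1 := by
    rcases hP b c hb hc hb1 hc1 hbc with h | h
    · exact absurd (mul_comm_of_involutions hb hc h) h2
    · exact h
  have hd : a * c * (a * c) = 1 := by rw [mul_assoc, h1, ← mul_assoc c, hc, one_mul, ha]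
  have hd1 : a * c ≠ 1 := fun h =>
    hac ((eq_inv_of_mul_eq_one_left h).trans (inv_eq_of_mul_eq_one_left hc))
  have hacb : a * c ≠ b := by
    rintro rfl
    apply hc1
    rwa [← mul_assoc, ha, one_mul, pow_succ, pow_two, hc, one_mul] at h3
  have hda : a ≠ a * c := fun h => hc1 (by simpa using h)
  rcases hP (a * c) b hd hb hd1 hb1 hacb with h | h
  · exact hP.not_commute_both ha hb hd hb1 hd1 hab hda h3 (by
        rw [← mul_assoc, ha, one_mul, mul_assoc, ← h1, ← mul_assoc, ha, one_mul])
      (mul_comm_of_involutions hd hb h).symm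
  · have r1 := braid_of_involutions ha hb h3
    have r2 := braid_of_involutions hb hc hbc3
    have hw : (a * c * b) ^ 2 = c * b * (a * c) * (b * c) := by
      calc (a * c * b) ^ 2 = a * c * b * (a * c * b) := pow_two _
        _ = c * a * b * (a * c * b) := by nth_rw 1 [h1]
        _ = c * (a * b * a) * c * b := by simp only [mul_assoc]
        _ = c * b * a * (b * c * b) := by rw [← r1]; simp only [mul_assoc]
        _ = c * b * (a * c) * (b * c) := by rw [← r2]; simp only [mul_assoc]
    have hw4 : (a * c * b) ^ 4 = 1 := by
      calc (a * c * b) ^ 4 = (a * c * b) ^ 2 * (a * c * b) ^ 2 := by rw [← pow_add]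
        _ = c * b * (a * c) * (b * (c * c) * b) * (a * c) * (b * c) := by
          rw [hw]; simp only [mul_assoc]
        _ = c * b * (a * c * (a * c)) * (b * c) := by
          rw [hc, mul_one, hb, mul_one]; simp only [mul_assoc]
        _ = c * (b * b) * c := by rw [hd, mul_one]; simp only [mul_assoc]
        _ = 1 := by rw [hb, mul_one, hc]
    rw [pow_succ, h, one_mul] at hw4
    exact hacb ((eq_inv_of_mul_eq_one_left hw4).trans (inv_eq_of_mul_eq_one_left hb))

/-- The relation behind the fact that, in a group of exponent three, every element commutes with its
conjugates. -/
theorem commute_conj_of_pow_three {u v : G} (hv : v ^ 3 = 1)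
    (huv : (u * v) ^ 3 = 1) (huv' : (u * v⁻¹) ^ 3 = 1) : Commute u (v * u * v⁻¹) := by
  have hv2 : v⁻¹ * v⁻¹ = v := by
    rw [← mul_inv_rev, inv_eq_iff_mul_eq_one, ← pow_two, ← pow_succ, hv]
  have e1 : v * u * v = u⁻¹ * v⁻¹ * u⁻¹ := by
    have : v * u * v * (u * v * u) = 1 := by
      have h : v * u * v * (u * v * u) = u⁻¹ * (u * v) ^ 3 * u := by
        simp only [pow_succ, pow_zero, one_mul, mul_assoc, inv_mul_cancel_left]
      rw [h, huv]; simp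
    rw [eq_inv_of_mul_eq_one_left this]; simp only [mul_inv_rev, mul_assoc]
  have e2 : v⁻¹ * u * v⁻¹ = u⁻¹ * v * u⁻¹ := by
    have : v⁻¹ * u * v⁻¹ * (u * v⁻¹ * u) = 1 := by
      have h : v⁻¹ * u * v⁻¹ * (u * v⁻¹ * u) = u⁻¹ * (u * v⁻¹) ^ 3 * u := by
        simp only [pow_succ, pow_zero, one_mul, mul_assoc, inv_mul_cancel_left]
      rw [h, huv']; simp
    rw [eq_inv_of_mul_eq_one_left this]; simp only [mul_inv_rev, inv_inv, mul_assoc]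
  have f1 : v * u * v⁻¹ = u⁻¹ * v⁻¹ * u⁻¹ * v := by
    have hvi : v * v = v⁻¹ := by rw [eq_inv_iff_mul_eq_one, ← pow_two, ← pow_succ, hv]
    rw [← e1, mul_assoc (v * u) v v, hvi]
  have f2 : v * u * v⁻¹ = v⁻¹ * (u⁻¹ * v * u⁻¹) := by
    rw [← e2]
    nth_rw 1 [← hv2]
    simp only [mul_assoc]
  show u * (v * u * v⁻¹) = v * u * v⁻¹ * u
  nth_rw 1 [f1]
  rw [f2]
  simp only [mul_assoc, mul_inv_cancel_left, inv_mul_cancel, mul_one]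

/-! ### Noncommuting involutions -/

theorem involutionProducts_of_inA [Finite G] (hA : InA 3 G) : InvolutionProducts G :=
  fun _ _ ha hb ha1 hb1 hab => mul_pow_eq_one_of_involutions hA ha hb ha1 hb1 hab

/-- Two noncommuting involutions generate all involutions: a third one `c` would give a group
`⟨a * b, a * c⟩` of exponent three with a character that is trivial at `a * b` and of order three at
`a * c`, and on the corresponding test function the square of `a + b + c` acts as `3`. -/
theorem eq_of_involution [Finite G] (hA : InA 3 G) {a b c : G}
    (ha : a * a = 1) (hb : b * b = 1) (hc : c * c = 1) (ha1 : a ≠ 1) (hb1 : b ≠ 1) (hc1 : c ≠ 1)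
    (hab : a ≠ b) (h3 : (a * b) ^ 3 = 1) : c = a ∨ c = b ∨ c = a * b * a := by
  by_contra hcon
  push Not at hcon
  obtain ⟨hca, hcb, hcd⟩ := hcon
  have hP := involutionProducts_of_inA hA
  have hai : a⁻¹ = a := inv_eq_of_mul_eq_one_left ha
  have hbi : b⁻¹ = b := inv_eq_of_mul_eq_one_left hb
  have hci : c⁻¹ = c := inv_eq_of_mul_eq_one_left hc
  have aa : ∀ g, a * (a * g) = g := fun g => by rw [← mul_assoc, ha, one_mul]
  have bb : ∀ g, b * (b * g) = g := fun g => by rw [← mul_assoc, hb, one_mul]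
  have cc : ∀ g, c * (c * g) = g := fun g => by rw [← mul_assoc, hc, one_mul]
  have hac3 : (a * c) ^ 3 = 1 := hP.pow_three ha hb hc ha1 hb1 hc1 hab hca.symm h3
  have hswap : ∀ {x y : G}, x * x = 1 → y * y = 1 → (x * y) ^ 3 = 1 → (y * x) ^ 3 = 1 := by
    intro x y hx hy h
    have : y * x = (x * y)⁻¹ := by
      rw [mul_inv_rev, inv_eq_of_mul_eq_one_left hx, inv_eq_of_mul_eq_one_left hy]
    rw [this, inv_pow, h, inv_one]
  have hbc3 : (b * c) ^ 3 = 1 :=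
    hP.pow_three hb ha hc hb1 ha1 hc1 hab.symm hcb.symm (hswap ha hb h3)
  have hd : a * b * a * (a * b * a) = 1 := by simp only [mul_assoc, aa, bb, ha]
  have hd1 : a * b * a ≠ 1 := by
    intro h
    apply hb1
    have : a * (a * b * a) * a = b := by simp only [mul_assoc, aa, ha, mul_one]
    rw [← this, h, mul_one, ha]
  have hcd3 : (a * b * a * c) ^ 3 = 1 := hswap hc hd
    (hP.pow_three hc ha hd hc1 ha1 hd1 hca hcd (hswap ha hc hac3))
  obtain ⟨u, hu⟩ : ∃ u, u = a * b := ⟨_, rfl⟩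
  obtain ⟨v, hv⟩ : ∃ v, v = a * c := ⟨_, rfl⟩
  have hui : u⁻¹ = b * a := by rw [hu, mul_inv_rev, hai, hbi]
  have hvi : v⁻¹ = c * a := by rw [hv, mul_inv_rev, hai, hci]
  have hu3 : u ^ 3 = 1 := hu ▸ h3
  have hv3 : v ^ 3 = 1 := hv ▸ hac3
  have huv : (u * v) ^ 3 = 1 := by rw [hu, hv, ← mul_assoc]; exact hcd3
  have huv' : (u * v⁻¹) ^ 3 = 1 := by
    have : u * v⁻¹ = a * (b * c) * a⁻¹ := by rw [hu, hvi, hai]; simp only [mul_assoc]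
    rw [this, conj_pow, hbc3, mul_one, mul_inv_cancel]
  have hvv : v⁻¹ * v⁻¹ = v := by
    rw [← mul_inv_rev, inv_eq_iff_mul_eq_one, ← pow_two, ← pow_succ, hv3]
  have hvv' : v * v = v⁻¹ := by rw [eq_inv_iff_mul_eq_one, ← pow_two, ← pow_succ, hv3]
  have c1 : Commute u (v * u * v⁻¹) := commute_conj_of_pow_three hv3 huv huv'
  have c2 : Commute u (v⁻¹ * u * v) := by
    simpa using commute_conj_of_pow_three (v := v⁻¹) (by rw [inv_pow, hv3, inv_one]) huv'
      (by rwa [inv_inv])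
  -- `M` is the normal closure of `u` in `⟨u, v⟩`.
  set s : Set G := {u, v * u * v⁻¹, v⁻¹ * u * v} with hs
  set M := Subgroup.closure s with hM
  have huM : u ∈ M := Subgroup.subset_closure (by simp [hs])
  have hnorm : ∀ h ∈ M, v⁻¹ * h * v ∈ M := by
    have : M ≤ M.comap (MulAut.conj v⁻¹).toMonoidHom := by
      rw [hM, Subgroup.closure_le]
      rintro x (rfl | rfl | rfl) <;> refine Subgroup.subset_closure ?_ <;> simp only [hs,
        MulEquiv.toMonoidHom_eq_coe, MonoidHom.coe_coe, MulAut.conj_apply, inv_inv]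
      · simp
      · left; simp only [mul_assoc, inv_mul_cancel, inv_mul_cancel_left, mul_one]
      · right; left
        have : v⁻¹ * (v⁻¹ * u * v) * v = v⁻¹ * v⁻¹ * u * (v * v) := by simp only [mul_assoc]
        rw [this, hvv, hvv']
    intro h hh
    simpa using this hh
  have hvM : v ∉ M := by
    intro hvM
    have hcent : M ≤ Subgroup.centralizer {u} := by
      rw [hM, Subgroup.closure_le]
      rintro x (rfl | rfl | rfl) <;> rw [SetLike.mem_coe, Subgroup.mem_centralizer_singleton_iff]
      · exact c1.eq.symm
      · exact c2.eq.symm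
    have hcomm : v * u = u * v := Subgroup.mem_centralizer_singleton_iff.1 (hcent hvM)
    have hz : M ≤ Subgroup.zpowers u := by
      rw [hM, Subgroup.closure_le]
      rintro x (rfl | rfl | rfl)
      · exact Subgroup.mem_zpowers _
      · rw [hcomm, mul_inv_cancel_right]; exact Subgroup.mem_zpowers _
      · rw [mul_assoc, ← hcomm, inv_mul_cancel_left]; exact Subgroup.mem_zpowers _
    obtain ⟨k, hk⟩ := (mem_powers_iff_mem_zpowers.2 (hz hvM) : v ∈ Submonoid.powers u)
    have hk' : u ^ (k % 3) = v := by rw [← hk]; exact (pow_eq_pow_mod k hu3).symm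
    have hlt : k % 3 < 3 := Nat.mod_lt _ (by norm_num)
    interval_cases k % 3
    · rw [pow_zero, hv] at hk'
      exact hca (by rw [← hai, inv_eq_of_mul_eq_one_right hk'.symm])
    · rw [pow_one, hu, hv] at hk'
      exact hcb (mul_left_cancel hk').symm
    · have : u ^ 2 = u⁻¹ := by rw [eq_inv_iff_mul_eq_one, ← pow_succ, hu3]
      rw [this, hui, hv] at hk'
      exact hcd (by rw [mul_assoc, hk', aa])
  obtain ⟨ζ, hζ, -⟩ := exists_root_of_unity (n := 3) (by norm_num)
  have hζ0 : ζ ≠ 0 := hζ.ne_zero (by norm_num)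
  have hsum : ζ + ζ⁻¹ = -1 := by
    have h1 := hζ.geom_sum_eq_zero (by norm_num)
    simp only [Finset.sum_range_succ, Finset.sum_range_zero, pow_zero, pow_one] at h1
    have h2 : ζ⁻¹ = ζ ^ 2 := inv_eq_of_mul_eq_one_right (by rw [← pow_succ', hζ.pow_eq_one])
    rw [h2]; linear_combination h1
  obtain ⟨f, hf, hfv, hfM⟩ := exists_semiinvariant M v (n := 3) (by norm_num) hv3 hnorm (by
    intro i hi h
    interval_cases i
    · rfl
    · rw [pow_one] at h; exact absurd h hvM
    · refine absurd ?_ hvM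
      rw [pow_two, hvv', inv_mem_iff] at h
      exact h) hζ.pow_eq_one
  have hfvi := inv_mul_eq_of_semiinvariant hζ0 hfv
  have fab : ∀ g, f (a * (b * g)) = f g := fun g => by rw [← mul_assoc, ← hu, hfM u huM]
  have fba : ∀ g, f (b * (a * g)) = f g := fun g => by
    rw [← mul_assoc, ← hui, hfM _ (inv_mem huM)]
  have fac : ∀ g, f (a * (c * g)) = ζ * f g := fun g => by rw [← mul_assoc, ← hv, hfv]
  have fca : ∀ g, f (c * (a * g)) = ζ⁻¹ * f g := fun g => by rw [← mul_assoc, ← hvi, hfvi]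
  have fbc : ∀ g, f (b * (c * g)) = ζ * f g := fun g => by rw [← aa (c * g), fba, fac]
  have fcb : ∀ g, f (c * (b * g)) = ζ⁻¹ * f g := fun g => by rw [← aa (b * g), fca, fab]
  have hS : IsConnectionSet ({a, b, c} : Set G) := by
    refine isConnectionSet_triple ha1 hb1 hc1 ?_
    rintro s (rfl | rfl | hs)
    · simp [hai]
    · simp [hbi]
    · rw [Set.mem_singleton_iff] at hs
      simp [hs, hci]
  obtain ⟨m, hm⟩ := exists_int_sq_of_triple hA hS hab hca.symm hcb.symm 0 (d := 3) hf
    (fun g => rfl) (by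
      intro g
      simp only [aa, bb, cc, fab, fba, fac, fca, fbc, fcb]
      push_cast
      linear_combination (2 * f g) * hsum)
  have hm' : m ^ 2 = 3 := by exact_mod_cast hm.symm
  obtain ⟨h1, h2⟩ := abs_lt_of_sq_lt_sq' (show m ^ 2 < 2 ^ 2 by omega) (by norm_num)
  interval_cases m <;> omega

theorem pow_eq_one_of_odd_orderOf {x : G} (hx : Odd (orderOf x)) {k j : ℕ}
    (h : x ^ (2 ^ j * k) = 1) : x ^ k = 1 := by
  rw [← orderOf_dvd_iff_pow_eq_one] at h ⊢
  exact (Nat.Coprime.dvd_mul_left ((Nat.coprime_two_right.2 hx).pow_right j)).1 h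

/-- The product `a * x` has even order, hence order dividing `4` or `6`. -/
theorem pow_three_of_commute_involution [Finite G] (hA : InA 3 G) {a x : G} (ha : a * a = 1)
    (ha1 : a ≠ 1) (hx : Odd (orderOf x)) (h : Commute a x) : x ^ 3 = 1 := by
  have hoa : orderOf a = 2 := orderOf_eq_prime (by rw [pow_two, ha]) ha1
  have hev : Even (orderOf (a * x)) := by
    rw [h.orderOf_mul_eq_mul_orderOf_of_coprime (by rw [hoa]; exact Nat.coprime_two_left.2 hx), hoa]
    exact even_two_mul _
  rcases pow_eq_one_of_even_orderOf hA hev with h4 | h6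
  · rw [h.mul_pow, show 4 = 2 * 2 from rfl, pow_mul a, pow_two a, ha, one_pow, one_mul] at h4
    have := pow_eq_one_of_odd_orderOf hx (k := 1) (j := 2) h4
    rw [pow_one] at this
    rw [this, one_pow]
  · rw [h.mul_pow, show 6 = 2 * 3 from rfl, pow_mul a, pow_two a, ha, one_pow, one_mul] at h6
    exact pow_eq_one_of_odd_orderOf hx (k := 3) (j := 1) h6

/-- Conjugation by `x` permutes the three involutions `a`, `b`, `a * b * a`. Either `x ^ 2`
centralises `a`, or `x` agrees with the rotation `a * b` up to an element of odd order
centralising `a`. -/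
theorem pow_three_of_conj_eq [Finite G] (hA : InA 3 G) {a b x : G}
    (ha : a * a = 1) (hb : b * b = 1) (ha1 : a ≠ 1) (hb1 : b ≠ 1)
    (hab : a ≠ b) (h3 : (a * b) ^ 3 = 1) (hx : Odd (orderOf x)) (hxa : x * a * x⁻¹ = b) :
    x ^ 3 = 1 := by
  have hai : a⁻¹ = a := inv_eq_of_mul_eq_one_left ha
  have hbi : b⁻¹ = b := inv_eq_of_mul_eq_one_left hb
  have aa : ∀ g, a * (a * g) = g := fun g => by rw [← mul_assoc, ha, one_mul]
  have bb : ∀ g, b * (b * g) = g := fun g => by rw [← mul_assoc, hb, one_mul]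
  have hbr := braid_of_involutions ha hb h3
  rcases eq_of_involution hA ha hb (c := x * b * x⁻¹) (by simp [mul_assoc, bb]) ha1 hb1
    (by rwa [Ne, conj_eq_one_iff]) hab h3 with h | h | h
  · have h1 : Commute a (x ^ 2) := by
      have : x ^ 2 * a * (x ^ 2)⁻¹ = a := by
        have e : x ^ 2 * a * (x ^ 2)⁻¹ = x * (x * a * x⁻¹) * x⁻¹ := by simp [pow_two, mul_assoc]
        rw [e, hxa, h]
      exact (mul_inv_eq_iff_eq_mul.1 this).symm
    have h2 := pow_three_of_commute_involution hA ha ha1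
      (Odd.of_dvd_nat hx (orderOf_pow_dvd 2)) h1
    rw [← pow_mul] at h2
    exact pow_eq_one_of_odd_orderOf hx (k := 3) (j := 1) h2
  · refine absurd ?_ hab
    have : x * a * x⁻¹ = x * b * x⁻¹ := by rw [hxa, h]
    exact mul_left_cancel (mul_right_cancel this)
  · have hxt : Commute (a * b) x := by
      have : x * (a * b) * x⁻¹ = a * b := by
        have e : x * (a * b) * x⁻¹ = x * a * x⁻¹ * (x * b * x⁻¹) := by simp [mul_assoc]
        rw [e, hxa, h, ← hbr]
        simp only [mul_assoc, bb]
      exact (mul_inv_eq_iff_eq_mul.1 this).symm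
    have hy : Commute a ((a * b)⁻¹ * x) := by
      have : (a * b)⁻¹ * x * a * ((a * b)⁻¹ * x)⁻¹ = a := by
        have e : (a * b)⁻¹ * x * a * ((a * b)⁻¹ * x)⁻¹ = (a * b)⁻¹ * (x * a * x⁻¹) * (a * b) := by
          simp [mul_assoc]
        rw [e, hxa, mul_inv_rev, hai, hbi, hbr]
        simp only [mul_assoc, aa, hb, mul_one]
      exact (mul_inv_eq_iff_eq_mul.1 this).symm
    have hodd : Odd (orderOf ((a * b)⁻¹ * x)) := by
      refine Odd.of_dvd_nat (n := 3 * orderOf x) ((by decide : Odd 3).mul hx)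
        (orderOf_dvd_of_pow_eq_one ?_)
      rw [hxt.inv_left.mul_pow, inv_pow, pow_mul (a * b), h3, one_pow, inv_one, one_mul,
        mul_comm, pow_mul, pow_orderOf_eq_one, one_pow]
    have h1 := pow_three_of_commute_involution hA ha ha1 hodd hy
    rwa [hxt.inv_left.mul_pow, inv_pow, h3, inv_one, one_mul] at h1

/-! ### Elements of odd order -/

/-- The commuting conjugates of `a` generate an elementary abelian `2`-group `M`, which meets `⟨x⟩`
trivially as `x` has odd order. On the test function for `M` and `x` the adjacency operator of
`Cay {a, x, x⁻¹}` acts as `1 + 2 cos (2π / n)`. -/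
theorem pow_three_of_commuting_conjugates [Finite G] (hA : InA 3 G) {a x : G} (ha : a * a = 1)
    (ha1 : a ≠ 1) (hx : Odd (orderOf x))
    (hcomm : ∀ i j : ℤ, Commute (x ^ i * a * (x ^ i)⁻¹) (x ^ j * a * (x ^ j)⁻¹)) : x ^ 3 = 1 := by
  by_cases hx1 : x = 1
  · rw [hx1, one_pow]
  have hpos := orderOf_pos x
  have h1 : orderOf x ≠ 1 := fun h => hx1 (orderOf_eq_one_iff.1 h)
  obtain ⟨j, hj⟩ := id hx
  have hx2 : x * x ≠ 1 := by
    intro h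
    have := pow_eq_one_of_odd_orderOf hx (k := 1) (j := 1) (by simpa [pow_two] using h)
    exact hx1 (by simpa using this)
  set s : Set G := Set.range fun i : ℤ => x ^ i * a * (x ^ i)⁻¹ with hs
  set M := Subgroup.closure s with hM
  have haM : a ∈ M := Subgroup.subset_closure ⟨0, by simp⟩
  have hMc : ∀ g ∈ M, ∀ h ∈ M, Commute g h := by
    have hc := Subgroup.isMulCommutative_closure (k := s) (by
      rintro _ ⟨i, rfl⟩ _ ⟨j, rfl⟩
      exact hcomm i j)
    intro g hg h hh
    exact congrArg Subtype.val (hc.is_comm.comm (⟨g, hg⟩ : M) ⟨h, hh⟩)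
  have hM2 : ∀ h ∈ M, h * h = 1 := by
    intro h hh
    refine Subgroup.closure_induction (p := fun h _ => h * h = 1) ?_ (mul_one 1) ?_ ?_ hh
    · rintro _ ⟨i, rfl⟩
      have : x ^ i * a * (x ^ i)⁻¹ * (x ^ i * a * (x ^ i)⁻¹) = x ^ i * (a * a) * (x ^ i)⁻¹ := by
        simp only [mul_assoc, inv_mul_cancel_left]
      simp only [this, ha, mul_one, mul_inv_cancel]
    · intro g k hg hk h1 h2
      rw [(hMc k hk g hg).mul_mul_mul_comm, h1, h2, mul_one]
    · intro g _ h1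
      rw [← mul_inv_rev, h1, inv_one]
  have hnorm : ∀ h ∈ M, x⁻¹ * h * x ∈ M := by
    have : M ≤ M.comap (MulAut.conj x⁻¹).toMonoidHom := by
      rw [hM, Subgroup.closure_le]
      rintro _ ⟨i, rfl⟩
      refine Subgroup.subset_closure ⟨i - 1, ?_⟩
      have e : x ^ (i - 1) = x⁻¹ * x ^ i := by rw [sub_eq_neg_add, zpow_add, zpow_neg_one]
      simp [e, mul_assoc]
    intro h hh
    simpa using this hh
  obtain ⟨ζ, hζ, hcos⟩ := exists_root_of_unity hpos
  have hζ0 : ζ ≠ 0 := hζ.ne_zero hpos.ne'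
  obtain ⟨f, hf, hfx, hfM⟩ := exists_semiinvariant M x hpos (pow_orderOf_eq_one x) hnorm (by
    intro i hi h
    by_contra h0
    refine pow_ne_one_of_lt_orderOf h0 hi (pow_eq_one_of_odd_orderOf hx (j := 1) ?_)
    rw [pow_one, two_mul, pow_add, hM2 _ h]) hζ.pow_eq_one
  have hai : a⁻¹ = a := inv_eq_of_mul_eq_one_left ha
  have hS : IsConnectionSet ({a, x, x⁻¹} : Set G) := by
    refine isConnectionSet_triple ha1 hx1 (inv_ne_one.2 hx1) ?_
    rintro s (rfl | rfl | rfl)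
    · simp [hai]
    · simp
    · simp
  have hax : a ≠ x := fun h => hx2 (h ▸ ha)
  obtain ⟨m, hm⟩ := exists_int_of_triple hA hS (μ := 1 + (ζ + ζ⁻¹)) hax
    (fun h => hax (by rw [← hai, h, inv_inv])) (fun h => hx2 (mul_eq_one_iff_eq_inv.2 h)) hf (by
      intro g
      rw [hfM a haM, hfx, inv_mul_eq_of_semiinvariant hζ0 hfx]
      ring)
  rcases eq_of_root_add_inv_int (by omega) hcos (k := m - 1)
    (by push_cast; rw [← hm]; ring) with h | h | h
  · rw [← h, pow_orderOf_eq_one]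
  · omega
  · omega

theorem pow_three_of_odd_orderOf [Finite G] (hA : InA 3 G) {a x : G} (ha : a * a = 1)
    (ha1 : a ≠ 1) (hx : Odd (orderOf x)) : x ^ 3 = 1 := by
  by_cases hcomm : ∀ i j : ℤ, Commute (x ^ i * a * (x ^ i)⁻¹) (x ^ j * a * (x ^ j)⁻¹)
  · exact pow_three_of_commuting_conjugates hA ha ha1 hx hcomm
  push Not at hcomm
  obtain ⟨i, j, hij⟩ := hcomm
  have hinv : ∀ y : G, y * a * y⁻¹ * (y * a * y⁻¹) = 1 := by
    intro y
    have : y * a * y⁻¹ * (y * a * y⁻¹) = y * (a * a) * y⁻¹ := by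
      simp only [mul_assoc, inv_mul_cancel_left]
    simp only [this, ha, mul_one, mul_inv_cancel]
  have hne : ∀ y : G, y * a * y⁻¹ ≠ 1 := fun y => by rwa [Ne, conj_eq_one_iff]
  obtain ⟨b, hb⟩ : ∃ b, b = x ^ i * a * (x ^ i)⁻¹ := ⟨_, rfl⟩
  obtain ⟨c, hc⟩ : ∃ c, c = x ^ j * a * (x ^ j)⁻¹ := ⟨_, rfl⟩
  rw [← hb, ← hc] at hij
  have hb2 : b * b = 1 := hb ▸ hinv _
  have hc2 : c * c = 1 := hc ▸ hinv _
  have hb1 : b ≠ 1 := hb ▸ hne _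
  have hc1 : c ≠ 1 := hc ▸ hne _
  have hbc : b ≠ c := fun h => hij (h ▸ Commute.refl b)
  have h3 : (b * c) ^ 3 = 1 := by
    rcases involutionProducts_of_inA hA b c hb2 hc2 hb1 hc1 hbc with h | h
    · exact absurd (mul_comm_of_involutions hb2 hc2 h) hij
    · exact h
  have hbi : b⁻¹ = b := inv_eq_of_mul_eq_one_left hb2
  have hci : c⁻¹ = c := inv_eq_of_mul_eq_one_left hc2
  have bb : ∀ g, b * (b * g) = g := fun g => by rw [← mul_assoc, hb2, one_mul]
  have cc : ∀ g, c * (c * g) = g := fun g => by rw [← mul_assoc, hc2, one_mul]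
  rcases eq_of_involution hA hb2 hc2 (c := x * b * x⁻¹) (by simp [mul_assoc, bb]) hb1 hc1
    (by rwa [Ne, conj_eq_one_iff]) hbc h3 with h | h | h
  · exact pow_three_of_commute_involution hA hb2 hb1 hx (mul_inv_eq_iff_eq_mul.1 h).symm
  · exact pow_three_of_conj_eq hA hb2 hc2 hb1 hc1 hbc h3 hx h
  · refine pow_three_of_conj_eq hA hb2 (by simp only [mul_assoc, bb, cc, hb2]) hb1 ?_ ?_ ?_ hx h
    · rw [← h]; rwa [Ne, conj_eq_one_iff]
    · intro e
      refine hij ?_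
      have : b * b = b * (b * c * b) := by rw [← e]
      rw [hb2, mul_assoc, bb] at this
      rw [← inv_eq_of_mul_eq_one_left this.symm] at hbc
      exact absurd hbi.symm hbc
    · have : b * (b * c * b) = (b * c)⁻¹ := by
        rw [mul_assoc, bb, mul_inv_rev, hbi, hci]
      rw [this, inv_pow, h3, inv_one]

/-! ### Cayley graphs of valency at most two -/

section TwoValent

variable {f : G → ℂ} {x : G} {ν : ℂ}

theorem sq_eq_four_of_pow_two (hf : f ≠ 0) (h : ∀ g, f (x * g) + f (x⁻¹ * g) = ν * f g)
    (hx : x ^ 2 = 1) : ν ^ 2 = 4 := by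
  obtain ⟨g, hg⟩ : ∃ g, f g ≠ 0 := Function.ne_iff.1 hf
  have hi : x⁻¹ = x := inv_eq_of_mul_eq_one_left (by rw [← pow_two, hx])
  rw [hi] at h
  have h0 := h g
  have h1 := h (x * g)
  rw [← mul_assoc, ← pow_two, hx, one_mul] at h1
  apply mul_right_cancel₀ hg
  linear_combination -ν * h0 - 2 * h1

theorem eq_of_pow_three (hf : f ≠ 0) (h : ∀ g, f (x * g) + f (x⁻¹ * g) = ν * f g)
    (hx : x ^ 3 = 1) : ν = 2 ∨ ν = -1 := by
  obtain ⟨g, hg⟩ : ∃ g, f g ≠ 0 := Function.ne_iff.1 hf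
  have hi : x⁻¹ = x * x := inv_eq_of_mul_eq_one_left (by rw [← pow_two, ← pow_succ, hx])
  have hxx : ∀ g, x * (x * (x * g)) = g := fun g => by
    rw [← mul_assoc, ← mul_assoc, ← pow_two, ← pow_succ, hx, one_mul]
  have h0 := h g
  have h1 := h (x * g)
  have h2 := h (x * (x * g))
  simp only [hi, mul_assoc, hxx] at h0 h1 h2
  have : (ν - 2) * (ν + 1) = 0 := by
    apply mul_right_cancel₀ hg
    linear_combination (1 - ν) * h0 - h1 - h2
  rcases mul_eq_zero.1 this with h | h
  · exact Or.inl (sub_eq_zero.1 h)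
  · exact Or.inr (eq_neg_of_add_eq_zero_left h)

theorem exists_int_of_sq_eq_sq {k : ℤ} (h : ν ^ 2 = (k : ℂ) ^ 2) : ∃ n : ℤ, ν = n := by
  rcases sq_eq_sq_iff_eq_or_eq_neg.1 h with h | h
  · exact ⟨k, h⟩
  · exact ⟨-k, by rw [h, Int.cast_neg]⟩

theorem exists_int_of_pow_four (hf : f ≠ 0) (h : ∀ g, f (x * g) + f (x⁻¹ * g) = ν * f g)
    (hx : x ^ 4 = 1) : ∃ n : ℤ, ν = n := by
  obtain ⟨g, hg⟩ : ∃ g, f g ≠ 0 := Function.ne_iff.1 hf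
  have hi : x⁻¹ = x * (x * x) :=
    inv_eq_of_mul_eq_one_left (by rw [← pow_two, ← pow_succ', ← pow_succ, hx])
  have hxx : ∀ g, x * (x * (x * (x * g))) = g := fun g => by
    rw [← mul_assoc, ← mul_assoc, ← mul_assoc, ← pow_two, ← pow_succ, ← pow_succ, hx, one_mul]
  have h0 := h g
  have h1 := h (x * g)
  have h2 := h (x * (x * g))
  have h3 := h (x * (x * (x * g)))
  simp only [hi, mul_assoc, hxx] at h0 h1 h2 h3
  have : ν * (ν ^ 2 - 2 ^ 2) = 0 := by
    apply mul_right_cancel₀ hg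
    linear_combination (2 - ν ^ 2) * h0 - ν * h1 - 2 * h2 - ν * h3
  rcases mul_eq_zero.1 this with h | h
  · exact ⟨0, by simpa using h⟩
  · exact exists_int_of_sq_eq_sq (k := 2) (by push_cast; exact sub_eq_zero.1 h)

theorem exists_int_of_pow_six (hf : f ≠ 0) (h : ∀ g, f (x * g) + f (x⁻¹ * g) = ν * f g)
    (hx : x ^ 6 = 1) : ∃ n : ℤ, ν = n := by
  -- `x ^ 2` has order dividing three, and `x ^ 2 + x⁻²` acts as `ν ^ 2 - 2`.
  have h2 : ∀ g, f (x ^ 2 * g) + f ((x ^ 2)⁻¹ * g) = (ν ^ 2 - 2) * f g := by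
    intro g
    have h0 := h g
    have h1 := h (x * g)
    have h2 := h (x⁻¹ * g)
    rw [inv_mul_cancel_left] at h1
    rw [mul_inv_cancel_left] at h2
    rw [pow_two, mul_inv_rev, mul_assoc, mul_assoc]
    linear_combination h1 + h2 + ν * h0
  rcases eq_of_pow_three hf h2 (by rw [← pow_mul, hx]) with h | h
  · exact exists_int_of_sq_eq_sq (k := 2) (by push_cast; linear_combination h)
  · exact exists_int_of_sq_eq_sq (k := 1) (by push_cast; linear_combination h)

end TwoValent

theorem isIntegralGraph_of_ncard_le_two [Finite G] (hord : ∀ x : G, x ^ 4 = 1 ∨ x ^ 6 = 1)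
    (hP : InvolutionProducts G) {S : Set G} (hS : IsConnectionSet S) (hcard : S.ncard ≤ 2) :
    IsIntegralGraph (Cay S) := by
  classical
  obtain ⟨T, rfl⟩ : ∃ T : Finset G, (T : Set G) = S := ⟨S.toFinite.toFinset, by simp⟩
  rw [Set.ncard_coe_finset] at hcard
  rw [isIntegralGraph_cay_iff hS]
  intro μ f hf hT
  obtain ⟨g, hg⟩ : ∃ g, f g ≠ 0 := Function.ne_iff.1 hf
  rcases (by omega : T.card = 0 ∨ T.card = 1 ∨ T.card = 2) with h | h | h
  · rw [Finset.card_eq_zero] at h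
    subst h
    have := hT g
    simp only [adjOp, Finset.sum_empty] at this
    exact ⟨0, by simpa [hg] using this.symm⟩
  · obtain ⟨a, rfl⟩ := Finset.card_eq_one.1 h
    have ha : a⁻¹ = a := by simpa using (hS.1 a).1 (by simp)
    simp only [adjOp, Finset.sum_singleton] at hT
    have h2 := hT (a * g)
    rw [hT g, ← mul_assoc, mul_eq_one_iff_eq_inv.2 ha.symm, one_mul] at h2
    have h3 : μ ^ 2 = 1 ^ 2 := by
      apply mul_right_cancel₀ hg
      linear_combination -h2
    rcases sq_eq_sq_iff_eq_or_eq_neg.1 h3 with h | h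
    · exact ⟨1, by simp [h]⟩
    · exact ⟨-1, by simp [h]⟩
  · obtain ⟨a, b, hab, rfl⟩ := Finset.card_eq_two.1 h
    have hT' : ∀ g, f (a * g) + f (b * g) = μ * f g := fun g => by
      rw [← hT, adjOp, Finset.sum_pair hab]
    have ha : a⁻¹ = a ∨ a⁻¹ = b := by simpa using (hS.1 a).1 (by simp)
    have hb : b⁻¹ = a ∨ b⁻¹ = b := by simpa using (hS.1 b).1 (by simp)
    by_cases hai : a⁻¹ = b
    · subst hai
      rcases hord a with h | h
      · exact exists_int_of_pow_four hf hT' h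
      · exact exists_int_of_pow_six hf hT' h
    · have ha := ha.resolve_right hai
      have hb := hb.resolve_left fun h => hai (by rw [← h, inv_inv])
      have ha2 : a * a = 1 := mul_eq_one_iff_eq_inv.2 ha.symm
      have hb2 : b * b = 1 := mul_eq_one_iff_eq_inv.2 hb.symm
      -- `(a + b) ^ 2 = 2 + a * b + (a * b)⁻¹`.
      have hr : ∀ g, f (a * b * g) + f ((a * b)⁻¹ * g) = (μ ^ 2 - 2) * f g := by
        intro g
        have h0 := hT' g
        have h1 := hT' (a * g)
        have h2 := hT' (b * g)
        rw [← mul_assoc, ha2, one_mul] at h1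
        rw [← mul_assoc b b, hb2, one_mul] at h2
        rw [mul_inv_rev, ha, hb, mul_assoc, mul_assoc]
        linear_combination h1 + h2 + μ * h0
      rcases hP a b ha2 hb2 (fun h => hS.2 (by simp [h])) (fun h => hS.2 (by simp [h])) hab
        with h | h
      · have h4 : (μ ^ 2 - 2) ^ 2 = 2 ^ 2 := by
          rw [sq_eq_four_of_pow_two hf hr h]; norm_num
        rcases sq_eq_sq_iff_eq_or_eq_neg.1 h4 with h | h
        · exact exists_int_of_sq_eq_sq (k := 2) (by push_cast; linear_combination h)
        · exact exists_int_of_sq_eq_sq (k := 0) (by push_cast; linear_combination h)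
      · rcases eq_of_pow_three hf hr h with h | h
        · exact exists_int_of_sq_eq_sq (k := 2) (by push_cast; linear_combination h)
        · exact exists_int_of_sq_eq_sq (k := 1) (by push_cast; linear_combination h)

/-! ### Connection sets of size three -/

theorem exists_involution_of_ncard_eq_three {S : Set G} (hS : IsConnectionSet S)
    (h3 : S.ncard = 3) : ∃ a : G, a ≠ 1 ∧ a * a = 1 := by
  obtain ⟨a, b, c, hab, hac, hbc, rfl⟩ := Set.ncard_eq_three.1 h3
  have h1 : ∀ s ∈ ({a, b, c} : Set G), s ≠ 1 := fun s hs h => hS.2 (h ▸ hs)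
  by_contra hcon
  push Not at hcon
  have hself : ∀ s ∈ ({a, b, c} : Set G), s⁻¹ ≠ s := fun s hs h =>
    hcon s (h1 s hs) (mul_eq_one_iff_eq_inv.2 h.symm)
  have ma : a ∈ ({a, b, c} : Set G) := by simp
  have mb : b ∈ ({a, b, c} : Set G) := by simp
  have mc : c ∈ ({a, b, c} : Set G) := by simp
  rcases (hS.1 a).1 ma with h | h | h
  · exact hself a ma h
  · rcases (hS.1 c).1 mc with h' | h' | h'
    · exact hbc (by rw [← h, ← h', inv_inv])
    · exact hac (by rw [← inv_inv a, h, ← h', inv_inv])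
    · exact hself c mc h'
  · rw [Set.mem_singleton_iff] at h
    rcases (hS.1 b).1 mb with h' | h' | h'
    · exact hbc (by rw [← h, ← h', inv_inv])
    · exact hself b mb h'
    · exact hab (by rw [← inv_inv a, h, ← (Set.mem_singleton_iff.1 h'), inv_inv])

theorem exists_ne_ne_of_two_lt_card {α : Type*} [Finite α] (h : 2 < Nat.card α) (a b : α) :
    ∃ y : α, y ≠ a ∧ y ≠ b := by
  by_contra hcon
  push Not at hcon
  have h1 : (Set.univ : Set α) ⊆ {a, b} := by
    intro y _
    by_cases hy : y = a
    · simp [hy]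
    · simp [hcon y hy]
  have h2 := Set.ncard_le_ncard h1
  rw [Set.ncard_univ] at h2
  have h3 := Set.ncard_insert_le a {b}
  rw [Set.ncard_singleton] at h3
  omega

/-- A group of order at least three with an involution has a cubic Cayley graph. -/
theorem exists_connectionSet_of_involution [Finite G] (hcard : 2 < Nat.card G) {x : G}
    (hx : x * x = 1) (hx1 : x ≠ 1) : ∃ S : Set G, IsConnectionSet S ∧ S.ncard = 3 := by
  have hxi : x⁻¹ = x := inv_eq_of_mul_eq_one_left hx
  obtain ⟨y, hy1, hyx⟩ := exists_ne_ne_of_two_lt_card hcard 1 x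
  have xx : ∀ g, x * (x * g) = g := fun g => by rw [← mul_assoc, hx, one_mul]
  by_cases hy : y⁻¹ = y
  · by_cases hc : x * y = y * x
    · refine ⟨{x, y, x * y}, isConnectionSet_triple hx1 hy1 ?_ ?_,
        Set.ncard_eq_three.2 ⟨x, y, x * y, hyx.symm, ?_, ?_, rfl⟩⟩
      · exact fun h => hyx (by rw [← hxi]; exact (inv_eq_of_mul_eq_one_right h).symm)
      · rintro s (rfl | rfl | hs)
        · simp [hxi]
        · simp [hy]
        · rw [Set.mem_singleton_iff] at hs
          simp [hs, hxi, hy, ← hc]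
      · simpa using hy1
      · simpa using hx1
    · refine ⟨{x, y, x * y * x⁻¹}, isConnectionSet_triple hx1 hy1 (by rwa [Ne, conj_eq_one_iff]) ?_,
        Set.ncard_eq_three.2 ⟨x, y, x * y * x⁻¹, hyx.symm, ?_, ?_, rfl⟩⟩
      · rintro s (rfl | rfl | hs)
        · simp [hxi]
        · simp [hy]
        · rw [Set.mem_singleton_iff] at hs
          simp [hs, hxi, hy, mul_assoc]
      · intro h
        exact hyx (mul_left_cancel (mul_inv_eq_iff_eq_mul.1 h.symm))
      · intro h
        exact hc (mul_inv_eq_iff_eq_mul.1 h.symm)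
  · refine ⟨{x, y, y⁻¹}, isConnectionSet_triple hx1 hy1 (inv_ne_one.2 hy1) ?_,
        Set.ncard_eq_three.2 ⟨x, y, y⁻¹, hyx.symm, ?_, Ne.symm hy, rfl⟩⟩
    · rintro s (rfl | rfl | rfl)
      · simp [hxi]
      · simp
      · simp
    · exact fun h => hyx (by rw [← hxi, h, inv_inv])

theorem isConnectionSet_pair {x : G} (hx1 : x ≠ 1) : IsConnectionSet ({x, x⁻¹} : Set G) := by
  refine ⟨fun s => ?_, by simp [hx1.symm, eq_comm, hx1]⟩
  simp only [Set.mem_insert_iff, Set.mem_singleton_iff, inv_eq_iff_eq_inv, inv_inv]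
  exact or_comm

theorem orderOf_of_isIntegralGraph_pair [Finite G] {x : G} (hx : x * x ≠ 1)
    (h : IsIntegralGraph (Cay ({x, x⁻¹} : Set G))) :
    orderOf x = 3 ∨ orderOf x = 4 ∨ orderOf x = 6 := by
  classical
  have hx1 : x ≠ 1 := by rintro rfl; exact hx (mul_one 1)
  have hne : x ≠ x⁻¹ := fun h => hx (mul_eq_one_iff_eq_inv.2 h)
  have hpos := orderOf_pos x
  have h3 : 3 ≤ orderOf x := by
    have h1 : orderOf x ≠ 1 := fun h => hx1 (orderOf_eq_one_iff.1 h)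
    have h2 : orderOf x ≠ 2 := fun h => hx (by rw [← pow_two, ← h, pow_orderOf_eq_one])
    omega
  have e : (({x, x⁻¹} : Finset G) : Set G) = {x, x⁻¹} := by simp
  have hS := isConnectionSet_pair hx1
  rw [← e] at h hS
  obtain ⟨ζ, hζ, hcos⟩ := exists_root_of_unity hpos
  obtain ⟨f, hf, hfx⟩ := exists_semiinvariant_orderOf x hζ.pow_eq_one
  obtain ⟨m, hm⟩ := (isIntegralGraph_cay_iff hS).1 h (ζ + ζ⁻¹) f hf fun g => by
    rw [adjOp, Finset.sum_pair hne, hfx,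
      inv_mul_eq_of_semiinvariant (hζ.ne_zero hpos.ne') hfx, add_mul]
  exact eq_of_root_add_inv_int h3 hcos hm

/-! ### Membership in the class of groups with integral Cayley graphs -/

theorem pow_four_or_pow_six_of_inA [Finite G] (hA : InA 3 G) (x : G) :
    x ^ 4 = 1 ∨ x ^ 6 = 1 := by
  rcases Nat.even_or_odd (orderOf x) with h | h
  · exact pow_eq_one_of_even_orderOf hA h
  · obtain ⟨S, hS, h3⟩ := hA.1
    obtain ⟨a, ha1, ha⟩ := exists_involution_of_ncard_eq_three hS h3
    right
    rw [show 6 = 3 * 2 from rfl, pow_mul, pow_three_of_odd_orderOf hA ha ha1 h, one_pow]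

theorem inG_three_of_inA [Finite G] (hA : InA 3 G) : InG 3 G := by
  intro S hS hcard
  rcases hcard.lt_or_eq with h | h
  · exact isIntegralGraph_of_ncard_le_two (pow_four_or_pow_six_of_inA hA)
      (involutionProducts_of_inA hA) hS (by omega)
  · exact hA.2 S hS h

theorem inG_three_of_pow_three [Finite G] (h3 : ∀ x : G, x ^ 3 = 1) : InG 3 G := by
  have hno : ∀ a : G, a * a = 1 → a = 1 := by
    intro a ha
    have := h3 a
    rwa [pow_succ, pow_two, ha, one_mul] at this
  intro S hS hcard
  rcases hcard.lt_or_eq with h | h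
  · exact isIntegralGraph_of_ncard_le_two
      (fun x => Or.inr (by rw [show 6 = 3 * 2 from rfl, pow_mul, h3, one_pow]))
      (fun a _ ha _ ha1 _ _ => absurd (hno a ha) ha1) hS (by omega)
  · obtain ⟨a, ha1, ha⟩ := exists_involution_of_ncard_eq_three hS h
    exact absurd (hno a ha) ha1

theorem inG_three_of_card_le_two [Finite G] (hcard : Nat.card G ≤ 2) : InG 3 G := by
  have hsq : ∀ x : G, x * x = 1 := by
    intro x
    have h1 : orderOf x ∣ Nat.card G := orderOf_dvd_natCard x
    have h2 : 0 < Nat.card G := Nat.card_pos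
    rw [← pow_two]
    interval_cases h : Nat.card G
    · rw [Nat.dvd_one, orderOf_eq_one_iff] at h1
      rw [h1, one_pow]
    · exact orderOf_dvd_iff_pow_eq_one.1 h1
  intro S hS _
  refine isIntegralGraph_of_ncard_le_two
    (fun x => Or.inl (by rw [show 4 = 2 * 2 from rfl, pow_mul, pow_two x, hsq, one_pow]))
    (fun a b _ _ _ _ _ => Or.inl (by rw [pow_two, hsq])) hS ?_
  have := Set.ncard_le_ncard (Set.subset_univ S)
  rw [Set.ncard_univ] at this
  omega

theorem pow_three_of_inG [Finite G] (hG : InG 3 G) (hcard : 2 < Nat.card G)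
    (hno : ¬ ∃ S : Set G, IsConnectionSet S ∧ S.ncard = 3) (x : G) : x ^ 3 = 1 := by
  have hinv : ∀ y : G, y * y = 1 → y = 1 := by
    intro y hy
    by_contra hy1
    exact hno (exists_connectionSet_of_involution hcard hy hy1)
  by_cases hx : x * x = 1
  · rw [hinv x hx, one_pow]
  have hS := isConnectionSet_pair (x := x) (by rintro rfl; exact hx (mul_one 1))
  have hle : ({x, x⁻¹} : Set G).ncard ≤ 3 := by
    have := Set.ncard_insert_le x {x⁻¹}
    rw [Set.ncard_singleton] at this
    omega
  have hhalf : ∀ k : ℕ, 0 < k → orderOf x ≠ k + k := by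
    intro k hk h
    refine pow_ne_one_of_lt_orderOf hk.ne' (by omega) (hinv (x ^ k) ?_)
    rw [← pow_add, ← h, pow_orderOf_eq_one]
  rcases orderOf_of_isIntegralGraph_pair hx (hG _ hS hle) with h | h | h
  · rw [← h, pow_orderOf_eq_one]
  · exact absurd h (hhalf 2 (by norm_num))
  · exact absurd h (hhalf 3 (by norm_num))

end CayleyIntegral

theorem corollary2p7 (G : Type*) [Group G] [Finite G] :
    CayleyIntegral.InG 3 G ↔
      (IsPGroup 3 G ∧ Monoid.exponent G = 3) ∨ CayleyIntegral.InA 3 G ∨ Nat.card G ≤ 2 := by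
  constructor
  · intro hG
    by_cases hS : ∃ S : Set G, CayleyIntegral.IsConnectionSet S ∧ S.ncard = 3
    · exact Or.inr (Or.inl ⟨hS, fun S h1 h2 => hG S h1 h2.le⟩)
    by_cases hcard : Nat.card G ≤ 2
    · exact Or.inr (Or.inr hcard)
    left
    push Not at hcard
    have h3 := CayleyIntegral.pow_three_of_inG hG hcard hS
    refine ⟨fun x => ⟨1, by rw [pow_one, h3]⟩, ?_⟩
    rcases (Nat.dvd_prime Nat.prime_three).1 (Monoid.exponent_dvd_of_forall_pow_eq_one h3)
      with h | h
    · obtain ⟨y, hy, -⟩ := CayleyIntegral.exists_ne_ne_of_two_lt_card hcard 1 1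
      exact absurd (by simpa [h] using Monoid.pow_exponent_eq_one y) hy
    · exact h
  · rintro (⟨-, h⟩ | h | h)
    · exact CayleyIntegral.inG_three_of_pow_three fun x => by
        rw [← h, Monoid.pow_exponent_eq_one]
    · exact CayleyIntegral.inG_three_of_inA h
    · exact CayleyIntegral.inG_three_of_card_le_two h
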